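/- Let $G$ be a totally disconnected metrizable locally compact group, with identity $e$, and let $\tau\in\operatorname{Aut}(G)$ be a topological automorphism of $G$ (a group automorphism that is also a homeomorphism). Let $\langle\tau\rangle=\{\tau^n : n\in\mathbb Z\}$ be the subgroup of $\operatorname{Aut}(G)$ generated by $\tau$, and for $\gamma\in\operatorname{Aut}(G)$ let $C(\gamma)=\{x\in G : \lim_{n\to\infty}\gamma^n(x)=e\}$ be its contraction subgroup. Then the following four conditions are equivalent: (i) $\tau$ is distal, i.e. for every $x\in G\setminus\{e\}$ the identity $e$ does not belong to the closure of the orbit $\{\gamma(x) : \gamma\in\langle\tau\rangle\}$; (ii) $C(\tau)=C(\tau^{-1})=\{e\}$; (iii) for every compact open subgroup $U$ of $G$ there exists an integer $k\ge 0$ such that $\tau\bigl(\bigcap_{i=0}^k\tau^i(U)\bigr)=\bigcap_{i=0}^k\tau^i(U)$; (iv) $\langle\tau\rangle$ is equicontinuous (at $e$), i.e. for every neighbourhood $W$ of $e$ there is a neighbourhood $V$ of $e$ such that $\gamma(V)\subseteq W$ for all $\gamma\in\langle\tau\rangle$. -/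

import Mathlib

open Filter Topology

namespace TopAut

/-- The group `Aut(G)` of topological automorphisms of `G` is `G ≃ₜ* G`, with composition as
multiplication: `(σ * τ) x = σ (τ x)`. -/
instance instGroup {G : Type*} [Group G] [TopologicalSpace G] : Group (G ≃ₜ* G) where
  mul σ τ := τ.trans σ
  one := ContinuousMulEquiv.refl G
  inv τ := τ.symm
  mul_assoc _ _ _ := rfl
  one_mul _ := rfl
  mul_one _ := rfl
  inv_mul_cancel τ := τ.self_trans_symm

variable {G : Type*} [Group G] [TopologicalSpace G]

@[simp] theorem one_apply (x : G) : (1 : G ≃ₜ* G) x = x := rfl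

@[simp] theorem mul_apply (σ τ : G ≃ₜ* G) (x : G) : (σ * τ) x = σ (τ x) := rfl

@[simp] theorem inv_apply (τ : G ≃ₜ* G) (x : G) : τ⁻¹ x = τ.symm x := rfl

/-- The orbit `Γx = {γ(x) ; γ ∈ Γ}`. -/
def orbit (Γ : Subgroup (G ≃ₜ* G)) (x : G) : Set G := {y | ∃ γ ∈ Γ, γ x = y}

/-- `Γ` acts distally on `G`: for `x ≠ e`, the identity is not in the closure of the orbit `Γx`. -/
def ActsDistally (Γ : Subgroup (G ≃ₜ* G)) : Prop :=
  ∀ x : G, x ≠ 1 → (1 : G) ∉ closure (orbit Γ x)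

/-- A single automorphism is distal if the subgroup it generates acts distally. -/
def IsDistal (τ : G ≃ₜ* G) : Prop := ActsDistally (Subgroup.zpowers τ)

/-- The contraction subgroup `C(τ) = {x ; τ ^ n (x) → e as n → ∞}`. -/
def contraction [IsTopologicalGroup G] (τ : G ≃ₜ* G) : Subgroup G where
  carrier := {x | Tendsto (fun n : ℕ => (τ ^ n) x) atTop (𝓝 1)}
  one_mem' := by simp [tendsto_const_nhds]
  mul_mem' {x y} hx hy := by
    simpa using Filter.Tendsto.mul hx hy
  inv_mem' {x} hx := by
    simpa using Filter.Tendsto.inv hx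

/-- `Γ` is equicontinuous (at the identity), as a family of maps from `G` to `G` with the
uniform structure of the topological group `G`. The right and the left uniform structure
give the same notion at the identity, because every `γ ∈ Γ` fixes it. -/
def IsEquicontinuous [IsTopologicalGroup G] (Γ : Subgroup (G ≃ₜ* G)) : Prop :=
  letI : UniformSpace G := IsTopologicalGroup.rightUniformSpace G
  EquicontinuousAt (fun (γ : Γ) (x : G) => (γ : G ≃ₜ* G) x) 1

/-- `Γ` is equicontinuous if and only if the `Γ`-invariant neighbourhoods of the identity form a
neighbourhood base there. -/
theorem isEquicontinuous_iff_hasBasis [IsTopologicalGroup G] (Γ : Subgroup (G ≃ₜ* G)) :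
    IsEquicontinuous Γ ↔
      (𝓝 (1 : G)).HasBasis (fun V => V ∈ 𝓝 (1 : G) ∧ ∀ γ ∈ Γ, γ '' V = V) id := by
  have key : IsEquicontinuous Γ ↔ ∀ U ∈ 𝓝 (1 : G), ∀ᶠ x in 𝓝 (1 : G), ∀ γ : Γ, γ.1 x ∈ U := by
    let : UniformSpace G := IsTopologicalGroup.rightUniformSpace G
    have hb : (uniformity G).HasBasis (fun U => U ∈ 𝓝 (1 : G))
        (fun U => (fun p : G × G => p.2 * p.1⁻¹) ⁻¹' U) := (𝓝 (1 : G)).basis_sets.comap _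
    refine (hb.equicontinuousAt_iff_right).trans ?_
    simp
  rw [key]
  constructor
  · intro h
    refine ⟨fun U => ⟨fun hU => ?_, fun ⟨V, hV, hVU⟩ => mem_of_superset hV.1 hVU⟩⟩
    refine ⟨{x | ∀ γ : Γ, γ.1 x ∈ U}, ⟨h U hU, fun γ hγ => ?_⟩, fun x hx => hx 1⟩
    ext y
    constructor
    · rintro ⟨x, hx, rfl⟩ δ
      exact hx (δ * ⟨γ, hγ⟩)
    · intro hy
      refine ⟨γ⁻¹ y, fun δ => hy (δ * (⟨γ, hγ⟩ : Γ)⁻¹), by simp⟩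
  · intro h U hU
    obtain ⟨V, ⟨hV, hinv⟩, hVU⟩ := h.mem_iff.1 hU
    filter_upwards [hV] with x hx γ
    exact hVU ((hinv γ.1 γ.2).le ⟨x, hx, rfl⟩)

end TopAut

/-!
The implications (i) → (ii) and (iii) → (iv) → (i) are soft, so everything rests on (ii) → (iii).

For a compact `τ`-invariant subgroup `K`, call `x` contracted modulo `K` if `τ ^ n x → K`. The key
fact is that every such `x` lies in `C(τ) K`. Given an open subgroup `V`, one first finds `h ∈ K`
with `τ ^ n (x h) ∈ V` for all large `n`: the steps of `τ ^ n x` inside `K` form an approximate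
orbit modulo `V`, which an exact orbit can shadow because `⋂ i ≤ k, τ ^ i V ∩ K` is tidy above for
large `k`. Then `x h` is contracted modulo the smaller group `K ∩ ⋂ i, τ ^ i V`. A minimal coset
`y L ⊆ x K` with `y` contracted modulo `L` exists by Zorn's lemma and compactness, and it must have
`L ≤ V` for every `V`, that is `L = {e}` and `y ∈ C(τ)`.

If `C(τ)` is trivial and `U` is a compact open subgroup, then `U₋ = {x | τ ^ n x ∈ U for n ≥ 0}` is
contracted modulo the invariant group `⋂ i, τ ^ i U`, hence equal to it. With the same for `τ⁻¹`,
compactness makes `⋂ i ≤ k, τ ^ i U` invariant for some `k`.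
-/

namespace TopAut

section NhdsSet

variable {X α : Type*} [TopologicalSpace X] {l : Filter α}

theorem tendsto_nhdsSet_inter_iInter {ι : Type*} {K : Set X} {F : ι → Set X} {u : α → X}
    (hK : IsCompact K) (hF : ∀ i, IsClosed (F i)) (hu : Tendsto u l (𝓝ˢ K))
    (huF : ∀ i, ∀ᶠ a in l, u a ∈ F i) : Tendsto u l (𝓝ˢ (K ∩ ⋂ i, F i)) := by
  refine (hasBasis_nhdsSet _).tendsto_right_iff.2 fun O ⟨hO, hKO⟩ => ?_
  obtain ⟨t, ht⟩ := (hK.diff hO).elim_finite_subfamily_closed F hF (by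
    rw [← Set.disjoint_iff_inter_eq_empty, Set.disjoint_left]
    exact fun x hx hxF => hx.2 (hKO ⟨hx.1, hxF⟩))
  have hopen : IsOpen (O ∪ (⋂ i ∈ t, F i)ᶜ) :=
    hO.union (isClosed_biInter fun i _ => hF i).isOpen_compl
  have hcover : K ⊆ O ∪ (⋂ i ∈ t, F i)ᶜ := fun x hx =>
    or_iff_not_imp_left.2 fun hxO hxF => ht.le ⟨⟨hx, hxO⟩, hxF⟩
  filter_upwards [hu (hopen.mem_nhdsSet.2 hcover), (eventually_all_finset t).2 fun i _ => huF i]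
    with a ha haF
  exact ha.resolve_right (not_not_intro (Set.mem_iInter₂.2 haF))

theorem tendsto_nhdsSet_iInter_of_directed [T2Space X] {ι : Type*} [Nonempty ι] {K : ι → Set X}
    {u : α → X} (hdir : Directed (· ⊇ ·) K) (hK : ∀ i, IsCompact (K i))
    (hu : ∀ i, Tendsto u l (𝓝ˢ (K i))) : Tendsto u l (𝓝ˢ (⋂ i, K i)) := by
  refine (hasBasis_nhdsSet _).tendsto_right_iff.2 fun O ⟨hO, hKO⟩ => ?_
  obtain ⟨i, hi⟩ := exists_subset_nhds_of_isCompact hdir hK fun x hx => hO.mem_nhds (hKO hx)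
  exact hu i (hO.mem_nhdsSet.2 hi)

theorem tendsto_nhdsSet_subgroup_mul {G : Type*} [Group G] [TopologicalSpace G] [ContinuousMul G]
    {K : Subgroup G} (hK : IsCompact (K : Set G)) {u w : α → G}
    (hu : Tendsto u l (𝓝ˢ (K : Set G))) (hw : Tendsto w l (𝓝ˢ (K : Set G))) :
    Tendsto (fun a => u a * w a) l (𝓝ˢ (K : Set G)) := by
  have huw : Tendsto (fun a => (u a, w a)) l (𝓝ˢ ((K : Set G) ×ˢ K)) := by
    rw [hK.nhdsSet_prod_eq hK]
    exact hu.prodMk hw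
  exact (continuous_mul.tendsto_nhdsSet fun p hp => K.mul_mem hp.1 hp.2).comp huw

end NhdsSet

section VanDantzig

open scoped Pointwise

variable {G : Type*} [Group G] [TopologicalSpace G] [IsTopologicalGroup G]

theorem isOpen_stabilizer_of_isCompact_of_isOpen {C : Set G} (hC : IsCompact C) (hCo : IsOpen C) :
    IsOpen (MulAction.stabilizer G C : Set G) := by
  obtain ⟨V, hV, hVC⟩ := compact_open_separated_mul_left hC hCo subset_rfl
  have hsub : ∀ g ∈ V, g • C ⊆ C := fun g hg => (Set.smul_set_subset_mul hg).trans hVC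
  refine Subgroup.isOpen_of_mem_nhds _ (g := 1) ?_
  filter_upwards [hV, inv_mem_nhds_one G hV] with g hg hg'
  exact (hsub g hg).antisymm (Set.subset_smul_set_iff.2 (hsub g⁻¹ hg'))

theorem nonarchimedeanGroup_of_totallyDisconnectedSpace [LocallyCompactSpace G]
    [TotallyDisconnectedSpace G] : NonarchimedeanGroup G where
  is_nonarchimedean W hW := by
    obtain ⟨K, hK, hKW, hKc⟩ := local_compact_nhds hW
    obtain ⟨C, hC, h1, hCK⟩ := (loc_compact_Haus_tot_disc_of_zero_dim (H := G)).mem_nhds_iff.1 hK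
    refine ⟨⟨MulAction.stabilizer G C, isOpen_stabilizer_of_isCompact_of_isOpen
      (hKc.of_isClosed_subset hC.isClosed hCK) hC.isOpen⟩, fun g hg => hKW (hCK ?_)⟩
    have hgC : g • C = C := hg
    rw [← hgC]
    exact ⟨1, h1, mul_one g⟩

theorem exists_isOpen_isCompact_subgroup_subset [LocallyCompactSpace G]
    [TotallyDisconnectedSpace G] {W : Set G} (hW : W ∈ 𝓝 1) :
    ∃ U : Subgroup G, IsOpen (U : Set G) ∧ IsCompact (U : Set G) ∧ (U : Set G) ⊆ W := by
  have := nonarchimedeanGroup_of_totallyDisconnectedSpace (G := G)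
  obtain ⟨K, hK, hKW, hKc⟩ := local_compact_nhds hW
  obtain ⟨U, hUK⟩ := NonarchimedeanGroup.is_nonarchimedean K hK
  exact ⟨U, U.isOpen, hKc.of_isClosed_subset U.isClosed hUK, hUK.trans hKW⟩

end VanDantzig

section Core

variable {G : Type*} [Group G] [TopologicalSpace G] {τ : G ≃ₜ* G} {V : Subgroup G}

theorem zpow_add_apply (τ : G ≃ₜ* G) (i j : ℤ) (x : G) : (τ ^ (i + j)) x = (τ ^ i) ((τ ^ j) x) := by
  rw [zpow_add, mul_apply]

theorem zpow_apply_pow_apply (τ : G ≃ₜ* G) (i : ℤ) (n : ℕ) (x : G) :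
    (τ ^ i) ((τ ^ n) x) = (τ ^ (i + n)) x := by
  rw [zpow_add_apply, zpow_natCast]

theorem image_eq_of_mem_zpowers {S : Set G} (h : τ '' S = S) {γ : G ≃ₜ* G}
    (hγ : γ ∈ Subgroup.zpowers τ) : γ '' S = S := by
  have hinv : ⇑τ⁻¹ '' S = S := by
    conv_lhs => rw [← h, Set.image_image]
    simp
  have hmul (σ ρ : G ≃ₜ* G) : ⇑(σ * ρ) '' S = σ '' (ρ '' S) := Set.image_comp σ ρ S
  obtain ⟨i, rfl⟩ := hγ
  induction i using Int.induction_on with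
  | zero => exact Set.image_id S
  | succ n ih => simp only [zpow_add_one, hmul, h, ih]
  | pred n ih => simp only [zpow_sub_one, hmul, hinv, ih]

theorem zpow_apply_mem_of_image_eq {S : Set G} (h : τ '' S = S) (i : ℤ) {x : G} (hx : x ∈ S) :
    (τ ^ i) x ∈ S :=
  (image_eq_of_mem_zpowers h ⟨i, rfl⟩).le ⟨x, hx, rfl⟩

/-- The subgroup `⋂ i ∈ I, τ ^ (-i) (V)` of the elements that `τ ^ i` sends into `V` for all
`i ∈ I`. In the usual notation, `V₊` is `core τ V (Set.Iic 0)` and `V₋` is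
`core τ V (Set.Ici 0)`. -/
def core (τ : G ≃ₜ* G) (V : Subgroup G) (I : Set ℤ) : Subgroup G where
  carrier := {x | ∀ i ∈ I, (τ ^ i) x ∈ V}
  one_mem' i _ := by simp
  mul_mem' hx hy i hi := by simpa using V.mul_mem (hx i hi) (hy i hi)
  inv_mem' hx i hi := by simpa using hx i hi

theorem mem_core {I : Set ℤ} {x : G} : x ∈ core τ V I ↔ ∀ i ∈ I, (τ ^ i) x ∈ V := Iff.rfl

theorem coe_core (τ : G ≃ₜ* G) (V : Subgroup G) (I : Set ℤ) :
    (core τ V I : Set G) = ⋂ i ∈ I, (τ ^ i) ⁻¹' (V : Set G) := by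
  ext x
  simp [mem_core]

theorem core_anti (τ : G ≃ₜ* G) (V : Subgroup G) : Antitone (core τ V) :=
  fun _ _ hIJ _ hx i hi => hx i (hIJ hi)

theorem core_le {I : Set ℤ} (h : 0 ∈ I) : core τ V I ≤ V :=
  fun x hx => by simpa using hx 0 h

theorem core_inv (τ : G ≃ₜ* G) (V : Subgroup G) (I : Set ℤ) :
    core τ⁻¹ V I = core τ V (Neg.neg ⁻¹' I) := by
  ext x
  simp only [mem_core, inv_zpow', Set.mem_preimage]
  exact ⟨fun h i hi => by simpa using h (-i) hi, fun h i hi => h (-i) (by simpa using hi)⟩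

theorem isClosed_core (τ : G ≃ₜ* G) (hV : IsClosed (V : Set G)) (I : Set ℤ) :
    IsClosed (core τ V I : Set G) := by
  rw [coe_core]
  exact isClosed_biInter fun i _ => hV.preimage (τ ^ i).continuous

theorem isOpen_core (τ : G ≃ₜ* G) (hV : IsOpen (V : Set G)) {I : Set ℤ} (hI : I.Finite) :
    IsOpen (core τ V I : Set G) := by
  rw [coe_core]
  exact hI.isOpen_biInter fun i _ => hV.preimage (τ ^ i).continuous

theorem image_core_univ (τ : G ≃ₜ* G) (V : Subgroup G) :
    τ '' (core τ V Set.univ : Set G) = core τ V Set.univ := by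
  have hzpow (i : ℤ) {x : G} (hx : x ∈ core τ V Set.univ) : (τ ^ i) x ∈ core τ V Set.univ :=
    fun j _ => by
      rw [← zpow_add_apply]
      exact hx _ trivial
  refine (Set.image_subset_iff.2 fun x hx => ?_).antisymm fun x hx => ?_
  · simpa using hzpow 1 hx
  · exact ⟨τ⁻¹ x, by simpa using hzpow (-1) hx, by simp⟩

theorem zpow_apply_mem_core_Iic {x : G} (hx : x ∈ core τ V (Set.Iic 0)) {i : ℤ} (hi : i ≤ 0) :
    (τ ^ i) x ∈ core τ V (Set.Iic 0) := fun j hj => by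
  rw [← zpow_add_apply]
  exact hx _ (Int.add_nonpos hj hi)

theorem apply_mem_core_Icc {k : ℕ} {x : G} (hx : x ∈ core τ V (Set.Icc (-k) 0)) (hτx : τ x ∈ V) :
    τ x ∈ core τ V (Set.Icc (-k) 0) := by
  rintro i ⟨hki, hi0⟩
  obtain rfl | hi := hi0.eq_or_lt
  · simpa using hτx
  · have hnext := hx (i + 1) ⟨by omega, by omega⟩
    rwa [zpow_add_apply, zpow_one] at hnext

theorem antitone_core_Icc (τ : G ≃ₜ* G) (V : Subgroup G) :
    Antitone fun k : ℕ => core τ V (Set.Icc (-k) 0) :=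
  fun m n hmn => core_anti τ V (Set.Icc_subset_Icc_left (by simpa using hmn))

theorem iInter_core_Icc (τ : G ≃ₜ* G) (V : Subgroup G) :
    ⋂ k : ℕ, (core τ V (Set.Icc (-k) 0) : Set G) = core τ V (Set.Iic 0) := by
  refine Set.Subset.antisymm (fun x hx i hi => ?_)
    (Set.subset_iInter fun k => core_anti τ V Set.Icc_subset_Iic_self)
  exact Set.mem_iInter.1 hx i.natAbs i ⟨by omega, hi⟩

theorem biInter_image_pow_eq_core (τ : G ≃ₜ* G) (U : Subgroup G) (k : ℕ) :
    ⋂ i ≤ k, (τ ^ i) '' (U : Set G) = core τ U (Set.Icc (-k) 0) := by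
  have himage (i : ℕ) : (τ ^ i) '' (U : Set G) = (τ ^ (-i : ℤ)) ⁻¹' (U : Set G) := by
    rw [zpow_neg, zpow_natCast]
    exact (τ ^ i).toEquiv.image_eq_preimage_symm U
  simp only [himage, coe_core]
  ext x
  simp only [Set.mem_iInter, Set.mem_Icc]
  refine ⟨fun h i hi => ?_, fun h i hi => h (-i) (by omega)⟩
  obtain ⟨j, rfl⟩ : ∃ j : ℕ, i = -j := ⟨i.natAbs, by omega⟩
  exact h j (by omega)

end Core

section Shadowing

open scoped Pointwise

variable {G : Type*} [Group G] [TopologicalSpace G] {τ : G ≃ₜ* G} {L P S V : Subgroup G} {y : G}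

/-- Shadowing on a finite time interval. The subgroup `S` makes `L ⊓ P` tidy: multiplying by an
element of `S` corrects the next step of an orbit without spoiling the earlier ones. -/
theorem exists_forall_mem_Icc_pow_apply_mem (hL : τ '' (L : Set G) = L) (hSLP : S ≤ L ⊓ P)
    (hS : ∀ s ∈ S, ∀ i ≤ (0 : ℤ), (τ ^ i) s ∈ S)
    (htidy : ∀ t ∈ L ⊓ P, ∃ s ∈ S, τ (t * s⁻¹) ∈ P) {N : ℕ}
    (hy : ∀ n ≥ N, ∃ v ∈ P ⊓ P.comap (τ : G →* G), ∃ l ∈ L, v * l = (τ ^ n) y)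
    {n : ℕ} (hn : N ≤ n) : ∃ h ∈ L, ∀ i ∈ Set.Icc N n, (τ ^ i) (y * h) ∈ P := by
  induction n, hn using Nat.le_induction with
  | base =>
    obtain ⟨v, hv, l, hl, hvl⟩ := hy N le_rfl
    refine ⟨(τ ^ (-N : ℤ)) l⁻¹, zpow_apply_mem_of_image_eq hL _ (L.inv_mem hl), fun i hi => ?_⟩
    obtain rfl : i = N := le_antisymm hi.2 hi.1
    have hcancel : (τ ^ i) ((τ ^ (-i : ℤ)) l⁻¹) = l⁻¹ := by simp
    rw [map_mul, hcancel, ← hvl, mul_inv_cancel_right]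
    exact hv.1
  | succ n hn ih =>
    obtain ⟨h, hhL, hh⟩ := ih
    obtain ⟨v, ⟨hvP, hτvP⟩, l, hl, hvl⟩ := hy n hn
    set t := l * (τ ^ n) h
    have hvt : (τ ^ n) (y * h) = v * t := by rw [map_mul, ← hvl, mul_assoc]
    have htL : t ∈ L := L.mul_mem hl (by simpa using zpow_apply_mem_of_image_eq hL n hhL)
    have htP : t ∈ P := (P.mul_mem_cancel_left hvP).1 (hvt ▸ hh n ⟨hn, le_rfl⟩)
    obtain ⟨s, hs, hts⟩ := htidy t ⟨htL, htP⟩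
    refine ⟨h * (τ ^ (-n : ℤ)) s⁻¹, L.mul_mem hhL
      (zpow_apply_mem_of_image_eq hL _ (L.inv_mem (hSLP hs).1)), fun i hi => ?_⟩
    obtain hin | rfl := Nat.le_succ_iff.1 hi.2
    · have hsi : (τ ^ i) ((τ ^ (-n : ℤ)) s) ∈ P := by
        rw [← zpow_natCast, ← zpow_add_apply]
        exact (hSLP (hS s hs _ (by omega))).2
      rw [← mul_assoc, map_mul, map_inv, map_inv]
      exact P.mul_mem (hh i ⟨hi.1, hin⟩) (P.inv_mem hsi)
    · have hcorrect : (τ ^ n) (y * (h * (τ ^ (-n : ℤ)) s⁻¹)) = v * (t * s⁻¹) := by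
        rw [← mul_assoc, map_mul, hvt, mul_assoc]
        simp
      rw [pow_succ', mul_apply, hcorrect, map_mul]
      exact P.mul_mem hτvP hts

variable [IsTopologicalGroup G] [T2Space G]

theorem exists_core_Icc_tidy (τ : G ≃ₜ* G) (hLc : IsCompact (L : Set G)) (hV : IsOpen (V : Set G)) :
    ∃ k : ℕ, ∀ t ∈ L ⊓ core τ V (Set.Icc (-k) 0), ∃ s ∈ L ⊓ core τ V (Set.Iic 0),
      τ (t * s⁻¹) ∈ core τ V (Set.Icc (-k) 0) := by
  set S : Subgroup G := L ⊓ core τ V (Set.Iic 0)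
  have hanti : Antitone fun k : ℕ => ((L ⊓ core τ V (Set.Icc (-k) 0) : Subgroup G) : Set G) :=
    fun m n hmn => inf_le_inf_left L (antitone_core_Icc τ V hmn)
  have hcompact (k : ℕ) : IsCompact ((L ⊓ core τ V (Set.Icc (-k) 0) : Subgroup G) : Set G) :=
    hLc.inter_right (isClosed_core τ (V.isClosed_of_isOpen hV) _)
  have hopen : IsOpen ((V.comap (τ : G →* G) : Set G) * (S : Set G)) :=
    (hV.preimage τ.continuous).mul_right
  have hinter : ⋂ k : ℕ, ((L ⊓ core τ V (Set.Icc (-k) 0) : Subgroup G) : Set G) = S := by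
    simp only [S, Subgroup.coe_inf, ← Set.inter_iInter, iInter_core_Icc]
  obtain ⟨k, hk⟩ := exists_subset_nhds_of_isCompact hanti.directed_ge hcompact fun x hx =>
    hopen.mem_nhds ⟨1, one_mem _, x, hinter.le hx, one_mul x⟩
  refine ⟨k, fun t ht => ?_⟩
  obtain ⟨v, hv, s, hs, rfl⟩ := hk ht
  refine ⟨s, hs, ?_⟩
  have hvcore : v ∈ core τ V (Set.Icc (-k) 0) :=
    ((core τ V _).mul_mem_cancel_right (core_anti τ V Set.Icc_subset_Iic_self hs.2)).1 ht.2
  simpa using apply_mem_core_Icc hvcore hv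

theorem exists_mul_eventually_pow_apply_mem (hLc : IsCompact (L : Set G))
    (hL : τ '' (L : Set G) = L) (hy : Tendsto (fun n : ℕ => (τ ^ n) y) atTop (𝓝ˢ (L : Set G)))
    (hV : IsOpen (V : Set G)) : ∃ h ∈ L, ∀ᶠ n : ℕ in atTop, (τ ^ n) (y * h) ∈ V := by
  obtain ⟨k, htidy⟩ := exists_core_Icc_tidy τ hLc hV
  set P : Subgroup G := core τ V (Set.Icc (-k) 0)
  have hP : IsOpen (P : Set G) := isOpen_core τ hV (Set.finite_Icc _ _)
  have hopen : IsOpen (((P ⊓ P.comap (τ : G →* G) : Subgroup G) : Set G) * (L : Set G)) :=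
    (hP.inter (hP.preimage τ.continuous)).mul_right
  obtain ⟨N, hN⟩ := eventually_atTop.1 (hy (hopen.mem_nhdsSet.2
    fun l hl => ⟨1, one_mem _, l, hl, one_mul l⟩))
  have hfinite (n : ℕ) : ∃ h ∈ L, ∀ i ∈ Set.Icc N (N + n), (τ ^ i) (y * h) ∈ P :=
    exists_forall_mem_Icc_pow_apply_mem hL
      (inf_le_inf_left L (core_anti τ V Set.Icc_subset_Iic_self))
      (fun s hs i hi => ⟨zpow_apply_mem_of_image_eq hL i hs.1, zpow_apply_mem_core_Iic hs.2 hi⟩)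
      htidy hN (Nat.le_add_right N n)
  let B (n : ℕ) : Set G := L ∩ ⋂ i ∈ Set.Icc N (N + n), (fun h => (τ ^ i) (y * h)) ⁻¹' P
  have hBclosed (n : ℕ) : IsClosed (B n) :=
    hLc.isClosed.inter (isClosed_biInter fun i _ => (P.isClosed_of_isOpen hP).preimage
      ((τ ^ i).continuous.comp (continuous_const_mul y)))
  obtain ⟨h, hh⟩ := IsCompact.nonempty_iInter_of_sequence_nonempty_isCompact_isClosed B
    (fun n => Set.inter_subset_inter_right _
      (Set.biInter_subset_biInter_left (Set.Icc_subset_Icc_right (Nat.le_succ _))))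
    (fun n => (hfinite n).imp fun h hh => ⟨hh.1, Set.mem_iInter₂.2 hh.2⟩)
    (hLc.of_isClosed_subset (hBclosed 0) Set.inter_subset_left) hBclosed
  rw [Set.mem_iInter] at hh
  refine ⟨h, (hh 0).1, eventually_atTop.2 ⟨N, fun n hn => ?_⟩⟩
  have hyP : (τ ^ n) (y * h) ∈ P := Set.mem_iInter₂.1 (hh n).2 n ⟨hn, Nat.le_add_left n N⟩
  exact core_le (by simp) hyP

end Shadowing

section Contraction

open scoped Pointwise

theorem mul_smul_coe_of_mem {G : Type*} [Group G] {L : Subgroup G} {h : G} (hh : h ∈ L) (y : G) :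
    (y * h) • (L : Set G) = y • (L : Set G) := by
  rw [mul_smul, smul_coe_set hh]

variable {G : Type*} [Group G] [TopologicalSpace G] {τ : G ≃ₜ* G} {L V : Subgroup G} {y : G}

/-- The element `x` lies in the relative contraction group `C(τ, K)` of a compact `τ`-invariant
subgroup `K`: its forward orbit converges to `K`, in the sense of eventually entering each
neighbourhood of the set `K`. -/
structure IsContractedModulo (τ : G ≃ₜ* G) (K : Subgroup G) (x : G) : Prop where
  isCompact : IsCompact (K : Set G)
  image_eq : τ '' (K : Set G) = K
  tendsto : Tendsto (fun n : ℕ => (τ ^ n) x) atTop (𝓝ˢ (K : Set G))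

/-- The cosets `y L` such that `y` is contracted modulo `L`. They are the sets to which Zorn's
lemma is applied. -/
def IsContractedCoset (τ : G ≃ₜ* G) (A : Set G) : Prop :=
  ∃ (L : Subgroup G) (y : G), IsContractedModulo τ L y ∧ y • (L : Set G) = A

theorem tendsto_nhdsSet_inf_core_univ (hL : IsCompact (L : Set G)) (hV : IsClosed (V : Set G))
    (hy : Tendsto (fun n : ℕ => (τ ^ n) y) atTop (𝓝ˢ (L : Set G)))
    (hyV : ∀ᶠ n : ℕ in atTop, (τ ^ n) y ∈ V) :
    Tendsto (fun n : ℕ => (τ ^ n) y) atTop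
      (𝓝ˢ ((L ⊓ core τ V Set.univ : Subgroup G) : Set G)) := by
  obtain ⟨N, hN⟩ := eventually_atTop.1 hyV
  rw [Subgroup.coe_inf, coe_core]
  simp only [Set.mem_univ, Set.iInter_true]
  refine tendsto_nhdsSet_inter_iInter hL (fun i => hV.preimage (τ ^ i).continuous) hy
    fun i => eventually_atTop.2 ⟨N + i.natAbs, fun n hn => ?_⟩
  obtain ⟨m, hm⟩ := Int.eq_ofNat_of_zero_le (a := i + n) (by omega)
  rw [Set.mem_preimage, zpow_apply_pow_apply, hm]
  simpa using hN m (by omega)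

theorem IsContractedModulo.inf_core_univ (hy : IsContractedModulo τ L y)
    (hV : IsClosed (V : Set G)) (hyV : ∀ᶠ n : ℕ in atTop, (τ ^ n) y ∈ V) :
    IsContractedModulo τ (L ⊓ core τ V Set.univ) y where
  isCompact := hy.isCompact.inter_right (isClosed_core τ hV _)
  image_eq := by rw [Subgroup.coe_inf, Set.image_inter τ.injective, hy.image_eq, image_core_univ]
  tendsto := tendsto_nhdsSet_inf_core_univ hy.isCompact hV hy.tendsto hyV

theorem IsContractedModulo.iInf [T2Space G] {ι : Type*} [Nonempty ι] {L : ι → Subgroup G}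
    (hdir : Directed (· ≥ ·) L) (hL : ∀ i, IsContractedModulo τ (L i) y) :
    IsContractedModulo τ (⨅ i, L i) y where
  isCompact := by
    obtain ⟨i⟩ := ‹Nonempty ι›
    rw [Subgroup.coe_iInf]
    exact (hL i).isCompact.of_isClosed_subset (isClosed_iInter fun j => (hL j).isCompact.isClosed)
      (Set.iInter_subset _ i)
  image_eq := by simp only [Subgroup.coe_iInf, Set.image_iInter τ.bijective, (hL _).image_eq]
  tendsto := by
    rw [Subgroup.coe_iInf]
    exact tendsto_nhdsSet_iInter_of_directed hdir (fun i => (hL i).isCompact)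
      fun i => (hL i).tendsto

theorem IsContractedCoset.nonempty {A : Set G} (hA : IsContractedCoset τ A) : A.Nonempty := by
  obtain ⟨L, y, -, rfl⟩ := hA
  exact (OneMemClass.coe_nonempty L).smul_set

variable [IsTopologicalGroup G]

theorem IsContractedCoset.isCompact {A : Set G} (hA : IsContractedCoset τ A) : IsCompact A := by
  obtain ⟨L, y, hy, rfl⟩ := hA
  exact hy.isCompact.smul y

theorem IsContractedModulo.mul_right (hy : IsContractedModulo τ L y) {h : G} (hh : h ∈ L) :
    IsContractedModulo τ L (y * h) where
  isCompact := hy.isCompact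
  image_eq := hy.image_eq
  tendsto := by
    have horbit (n : ℕ) : (τ ^ n) h ∈ L := by
      simpa using zpow_apply_mem_of_image_eq hy.image_eq n hh
    simpa only [map_mul] using tendsto_nhdsSet_subgroup_mul hy.isCompact hy.tendsto
      ((tendsto_principal.2 (Eventually.of_forall horbit)).mono_right principal_le_nhdsSet)

theorem IsContractedCoset.exists_isContractedModulo {A : Set G} (hA : IsContractedCoset τ A)
    (hy : y ∈ A) : ∃ L : Subgroup G, IsContractedModulo τ L y ∧ y • (L : Set G) = A := by
  obtain ⟨L, z, hz, rfl⟩ := hA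
  obtain ⟨l, hl, rfl⟩ := hy
  exact ⟨L, hz.mul_right hl, mul_smul_coe_of_mem hl z⟩

variable [T2Space G]

theorem IsContractedModulo.exists_inf_core_univ (hy : IsContractedModulo τ L y)
    (hV : IsOpen (V : Set G)) : ∃ h ∈ L, IsContractedModulo τ (L ⊓ core τ V Set.univ) (y * h) := by
  obtain ⟨h, hh, hyV⟩ :=
    exists_mul_eventually_pow_apply_mem hy.isCompact hy.image_eq hy.tendsto hV
  exact ⟨h, hh, (hy.mul_right hh).inf_core_univ (V.isClosed_of_isOpen hV) hyV⟩

theorem exists_isContractedCoset_subset_of_isChain {c : Set (Set G)}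
    (hc : ∀ A ∈ c, IsContractedCoset τ A) (hchain : IsChain (· ⊆ ·) c) (hne : c.Nonempty) :
    ∃ B, IsContractedCoset τ B ∧ ∀ A ∈ c, B ⊆ A := by
  have : Nonempty c := hne.to_subtype
  have hdir : DirectedOn (· ⊇ ·) c := fun A hA B hB => by
    obtain hAB | hBA := hchain.total hA hB
    · exact ⟨A, hA, subset_rfl, hAB⟩
    · exact ⟨B, hB, hBA, subset_rfl⟩
  obtain ⟨y, hy⟩ := IsCompact.nonempty_sInter_of_directed_nonempty_isCompact_isClosed hdir
    (fun A hA => (hc A hA).nonempty) (fun A hA => (hc A hA).isCompact)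
    (fun A hA => (hc A hA).isCompact.isClosed)
  choose L hL hLA using fun A : c => (hc A A.2).exists_isContractedModulo (hy A A.2)
  have hdirL : Directed (· ≥ ·) L := fun A B => by
    obtain ⟨C, hCA, hCB⟩ := hdir.directed_val A B
    rw [← hLA, ← hLA] at hCA hCB
    exact ⟨C, Set.smul_set_subset_smul_set_iff.1 hCA, Set.smul_set_subset_smul_set_iff.1 hCB⟩
  exact ⟨_, ⟨_, y, .iInf hdirL hL, rfl⟩, fun A hA =>
    (Set.smul_set_mono (iInf_le L ⟨A, hA⟩)).trans (hLA ⟨A, hA⟩).le⟩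

theorem le_of_minimal_isContractedCoset (hy : IsContractedModulo τ L y)
    (hmin : Minimal (IsContractedCoset τ) (y • (L : Set G))) (hV : IsOpen (V : Set G)) : L ≤ V := by
  obtain ⟨h, hh, hyh⟩ := hy.exists_inf_core_univ hV
  have hle := hmin.le_of_le ⟨_, _, hyh, rfl⟩
  rw [← mul_smul_coe_of_mem hh y, Set.smul_set_subset_smul_set_iff,
    Set.smul_set_subset_smul_set_iff] at hle
  exact fun z hz => core_le (Set.mem_univ _) (hle (fun w hw => hw.1) hz).2

end Contraction

section Nonarchimedean

open scoped Pointwise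

variable {G : Type*} [Group G] [TopologicalSpace G] [NonarchimedeanGroup G] [T2Space G]
  {τ : G ≃ₜ* G} {K U : Subgroup G} {x : G}

theorem eq_bot_of_forall_isOpen_le (hK : ∀ V : Subgroup G, IsOpen (V : Set G) → K ≤ V) :
    K = ⊥ := by
  refine (Subgroup.eq_bot_iff_forall K).2 fun x hx => by_contra fun hx1 => ?_
  obtain ⟨V, hV⟩ := NonarchimedeanGroup.is_nonarchimedean _ (isOpen_ne.mem_nhds (Ne.symm hx1))
  exact hV (hK V V.isOpen hx) rfl

theorem IsContractedModulo.exists_mul_mem_contraction (hx : IsContractedModulo τ K x) :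
    ∃ h ∈ K, x * h ∈ contraction τ := by
  obtain ⟨A, hAx, hmin⟩ := zorn_superset_nonempty {A | IsContractedCoset τ A}
    (fun c hc hchain hne => exists_isContractedCoset_subset_of_isChain hc hchain hne)
    (x • (K : Set G)) ⟨K, x, hx, rfl⟩
  obtain ⟨L, y, hy, rfl⟩ := hmin.prop
  obtain rfl : L = ⊥ := eq_bot_of_forall_isOpen_le fun V hV =>
    le_of_minimal_isContractedCoset hy hmin hV
  obtain ⟨h, hh, rfl⟩ := hAx ⟨1, one_mem _, mul_one y⟩
  have hlim : Tendsto (fun n : ℕ => (τ ^ n) (x * h)) atTop (𝓝 1) := by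
    simpa only [smul_eq_mul, Subgroup.coe_bot, nhdsSet_singleton] using hy.tendsto
  exact ⟨h, hh, hlim⟩

theorem core_Ici_eq_core_univ (hτ : contraction τ = ⊥) (hUc : IsCompact (U : Set G)) :
    core τ U (Set.Ici 0) = core τ U Set.univ := by
  refine le_antisymm (fun x hx => ?_) (core_anti τ U (Set.subset_univ _))
  have horbit : ∀ᶠ n : ℕ in atTop, (τ ^ n) x ∈ U :=
    Eventually.of_forall fun n => by simpa using hx n (Int.natCast_nonneg n)
  have hlim : Tendsto (fun n : ℕ => (τ ^ n) x) atTop (𝓝ˢ (U : Set G)) :=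
    (tendsto_principal.2 horbit).mono_right principal_le_nhdsSet
  have hxK : IsContractedModulo τ (core τ U Set.univ) x :=
    { isCompact := hUc.of_isClosed_subset (isClosed_core τ hUc.isClosed _)
        (core_le (Set.mem_univ 0))
      image_eq := image_core_univ τ U
      tendsto := by
        simpa only [inf_eq_right.2 (core_le (τ := τ) (V := U) (Set.mem_univ 0))] using
          tendsto_nhdsSet_inf_core_univ hUc hUc.isClosed hlim horbit }
  obtain ⟨h, hh, hc⟩ := hxK.exists_mul_mem_contraction
  rw [hτ, Subgroup.mem_bot] at hc
  rw [eq_inv_of_mul_eq_one_left hc]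
  exact Subgroup.inv_mem _ hh

theorem core_Iic_eq_core_univ (hτ : contraction τ⁻¹ = ⊥) (hUc : IsCompact (U : Set G)) :
    core τ U (Set.Iic 0) = core τ U Set.univ := by
  simpa [core_inv] using core_Ici_eq_core_univ hτ hUc

theorem exists_core_Icc_eq_core_univ (h₁ : contraction τ = ⊥) (h₂ : contraction τ⁻¹ = ⊥)
    (hU : IsOpen (U : Set G)) (hUc : IsCompact (U : Set G)) :
    ∃ k : ℕ, core τ U (Set.Icc (-k) 0) = core τ U Set.univ := by
  have hcompact (k : ℕ) : IsCompact (core τ U (Set.Icc (-k) 0) : Set G) :=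
    hUc.of_isClosed_subset (isClosed_core τ hUc.isClosed _) (core_le (by simp))
  obtain ⟨k, hk⟩ := exists_subset_nhds_of_isCompact (U := τ ⁻¹' (U : Set G))
    (antitone_core_Icc τ U).directed_ge hcompact fun x hx => by
      rw [iInter_core_Icc, core_Iic_eq_core_univ h₂ hUc] at hx
      have hτx : τ x ∈ U := by simpa only [zpow_one] using hx 1 trivial
      exact (hU.preimage τ.continuous).mem_nhds hτx
  refine ⟨k, le_antisymm (fun x hx => ?_) (core_anti τ U (Set.subset_univ _))⟩
  have horbit (n : ℕ) : (τ ^ n) x ∈ core τ U (Set.Icc (-k) 0) := by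
    induction n with
    | zero => exact hx
    | succ n ih =>
      rw [pow_succ', mul_apply]
      exact apply_mem_core_Icc ih (hk ih)
  rw [← core_Ici_eq_core_univ h₁ hUc]
  intro i hi
  lift i to ℕ using hi
  simpa using core_le (by simp) (horbit i)

end Nonarchimedean

section Equicontinuity

variable {G : Type*} [Group G] [TopologicalSpace G] [IsTopologicalGroup G]
  {Γ : Subgroup (G ≃ₜ* G)} {τ γ : G ≃ₜ* G}

theorem ActsDistally.contraction_eq_bot (h : ActsDistally Γ) (hγ : γ ∈ Γ) : contraction γ = ⊥ := by
  refine (Subgroup.eq_bot_iff_forall _).2 fun x hx => by_contra fun hne => h x hne ?_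
  have hlim : Tendsto (fun n : ℕ => (γ ^ n) x) atTop (𝓝 1) := hx
  exact mem_closure_of_tendsto hlim (Eventually.of_forall fun n => ⟨γ ^ n, pow_mem hγ n, rfl⟩)

theorem IsEquicontinuous.actsDistally [T1Space G] (h : IsEquicontinuous Γ) : ActsDistally Γ := by
  intro x hx hcl
  obtain ⟨V, ⟨hV, hinv⟩, hVx⟩ := ((isEquicontinuous_iff_hasBasis Γ).1 h).mem_iff.1
    (isOpen_ne.mem_nhds hx.symm)
  obtain ⟨_, hγx, γ, hγ, rfl⟩ := mem_closure_iff_nhds.1 hcl V hV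
  have hxV : x ∈ V := by simpa using (hinv γ⁻¹ (inv_mem hγ)).le ⟨_, hγx, rfl⟩
  exact hVx hxV rfl

theorem isEquicontinuous_zpowers_of_exists_image_eq
    (h : ∀ W ∈ 𝓝 (1 : G), ∃ V ∈ 𝓝 1, V ⊆ W ∧ τ '' V = V) :
    IsEquicontinuous (Subgroup.zpowers τ) := by
  rw [isEquicontinuous_iff_hasBasis]
  refine ⟨fun W => ⟨fun hW => ?_, fun ⟨V, hV, hVW⟩ => mem_of_superset hV.1 hVW⟩⟩
  obtain ⟨V, hV, hVW, hτV⟩ := h W hW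
  exact ⟨V, ⟨hV, fun γ hγ => image_eq_of_mem_zpowers hτV hγ⟩, hVW⟩

end Equicontinuity

end TopAut

open TopAut in
theorem proposition2p1_general {G : Type*} [Group G] [TopologicalSpace G] [IsTopologicalGroup G]
    [LocallyCompactSpace G] [TotallyDisconnectedSpace G] (τ : G ≃ₜ* G) :
    List.TFAE [
      IsDistal τ,
      contraction τ = ⊥ ∧ contraction τ⁻¹ = ⊥,
      ∀ U : Subgroup G, IsOpen (U : Set G) → IsCompact (U : Set G) →
        ∃ k : ℕ, τ '' (⋂ i ≤ k, (τ ^ i) '' (U : Set G)) = ⋂ i ≤ k, (τ ^ i) '' (U : Set G),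
      IsEquicontinuous (Subgroup.zpowers τ)] := by
  have := nonarchimedeanGroup_of_totallyDisconnectedSpace (G := G)
  simp only [biInter_image_pow_eq_core]
  tfae_have 1 → 2 := fun h => ⟨h.contraction_eq_bot (Subgroup.mem_zpowers τ),
    h.contraction_eq_bot (inv_mem (Subgroup.mem_zpowers τ))⟩
  tfae_have 2 → 3 := by
    rintro ⟨h₁, h₂⟩ U hU hUc
    obtain ⟨k, hk⟩ := exists_core_Icc_eq_core_univ h₁ h₂ hU hUc
    exact ⟨k, by rw [hk, image_core_univ]⟩
  tfae_have 3 → 4 := by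
    refine fun h => isEquicontinuous_zpowers_of_exists_image_eq fun W hW => ?_
    obtain ⟨U, hU, hUc, hUW⟩ := exists_isOpen_isCompact_subgroup_subset hW
    obtain ⟨k, hk⟩ := h U hU hUc
    have hopen := isOpen_core τ hU (Set.finite_Icc (-k : ℤ) 0)
    exact ⟨_, hopen.mem_nhds (one_mem _), fun x hx => hUW (core_le (by simp) hx), hk⟩
  tfae_have 4 → 1 := IsEquicontinuous.actsDistally
  tfae_finish

theorem proposition2p1 {G : Type*} [Group G] [TopologicalSpace G] [IsTopologicalGroup G]
    [LocallyCompactSpace G] [TotallyDisconnectedSpace G] [TopologicalSpace.MetrizableSpace G]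
    (τ : G ≃ₜ* G) :
    List.TFAE [
      TopAut.IsDistal τ,
      TopAut.contraction τ = ⊥ ∧ TopAut.contraction τ⁻¹ = ⊥,
      ∀ U : Subgroup G, IsOpen (U : Set G) → IsCompact (U : Set G) →
        ∃ k : ℕ, τ '' (⋂ i ≤ k, (τ ^ i) '' (U : Set G)) = ⋂ i ≤ k, (τ ^ i) '' (U : Set G),
      TopAut.IsEquicontinuous (Subgroup.zpowers τ)] :=
  proposition2p1_general τ
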